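/- Let $\overline{\mathbb{Q}}\subset\mathbb{C}$ be the field of algebraic numbers. A function $f$ from the positive integers to $\mathbb{C}$ is called an algebraic function over a subfield $K\subseteq\mathbb{C}$ if there exist $k\ge 0$ and polynomials $q_0,\dots,q_k\in K[x]$ with $q_k\neq 0$ such that $q_k(n)f(n)^k+\cdots+q_1(n)f(n)+q_0(n)=0$ for every positive integer $n$; otherwise $f$ is called a transcendental function over $K$. Then the functions $$F(n)=\sum_{j=1}^n\frac{(-1)^{j-1}}{j},\qquad L(n)=\sum_{j=1}^n\frac{(-1)^{j-1}}{2j-1},\qquad S(n)=\sum_{j=1}^n\frac{1}{j!}$$ are transcendental functions of $n$ over $\overline{\mathbb{Q}}$. Moreover, $$\lim_{n\to\infty}F(n)=\ln 2,\qquad \lim_{n\to\infty}L(n)=\frac{\pi}{4},\qquad \lim_{n\to\infty}S(n)=e-1,$$ and the numbers $\ln 2$, $\pi/4$ and $e-1$ are transcendental (over $\mathbb{Q}$). -/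

import Mathlib

open Filter Topology Polynomial

noncomputable section

/-- A complex-valued function `f` of one positive integer variable is an algebraic function over the
subfield `K` of `ℂ` if there are polynomials `q 0, …, q k` over `K` with `q k ≠ 0` such that
`q k (n) * f(n)^k + ⋯ + q 1 (n) * f(n) + q 0 (n) = 0` for every positive integer `n`. -/
def IsAlgebraicFunction (K : Subfield ℂ) (f : ℕ+ → ℂ) : Prop :=
  ∃ (k : ℕ) (q : Fin (k + 1) → K[X]), q (Fin.last k) ≠ 0 ∧
    ∀ n : ℕ+, ∑ i : Fin (k + 1), aeval ((n : ℕ) : ℂ) (q i) * f n ^ (i : ℕ) = 0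

/-- A transcendental function over `K` is one that is not algebraic over `K`. -/
def IsTranscendentalFunction (K : Subfield ℂ) (f : ℕ+ → ℂ) : Prop :=
  ¬ IsAlgebraicFunction K f

/-- The field of algebraic numbers, as a subfield of `ℂ`. -/
def algebraicNumbers : Subfield ℂ := (algebraicClosure ℚ ℂ).toSubfield

/-- `∑_{j=1}^n (-1)^(j-1) / j`. -/
def altHarmonicSum (n : ℕ+) : ℂ :=
  ∑ j ∈ Finset.Icc 1 (n : ℕ), (-1 : ℂ) ^ (j - 1) / (j : ℂ)

/-- `∑_{j=1}^n (-1)^(j-1) / (2j-1)`. -/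
def leibnizSum (n : ℕ+) : ℂ :=
  ∑ j ∈ Finset.Icc 1 (n : ℕ), (-1 : ℂ) ^ (j - 1) / (2 * (j : ℂ) - 1)

/-- `∑_{j=1}^n 1 / j!`. -/
def invFactorialSum (n : ℕ+) : ℂ :=
  ∑ j ∈ Finset.Icc 1 (n : ℕ), 1 / (Nat.factorial j : ℂ)

end

/-!
If `f` is an algebraic function over `K` and `f n` tends to `l`, dividing the polynomial equation
for `f` by the highest power of `n` occurring in it and passing to the limit gives a nonzero
polynomial over `K` that vanishes at `l` (`IsAlgebraicFunction.isAlgebraic_of_tendsto`). Hence a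
function whose limit is a transcendental number is transcendental over the field of algebraic
numbers, and it is enough to find the limits of the three sums and to show that `log 2`, `π / 4` and
`e - 1` are transcendental.

The transcendence follows from the Hermite–Lindemann theorem
(`transcendental_cexp_of_isAlgebraic`): `exp α` is transcendental for algebraic `α ≠ 0`. It is
applied to `α = log 2`, `α = π * I` and `α = 1`. It is a case of the linear independence over `ℤ` of
the exponentials of distinct elements of a Galois number field `K`, that is, of the injectivity of
the map `ℤ[K] → ℂ` on the group ring of `(K, +)` (`expLift_injective`). The group ring is a domain,
so from a nonzero kernel element one gets, by taking the norm and multiplying by a suitable orbit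
sum, a Galois-invariant kernel element with nonzero coefficient at the exponent `0`. Such an element
cannot exist (`sum_mul_cexp_ne_zero_of_forall_algEquiv`): the simultaneous approximations
`LindemannWeierstrass.exp_polynomial_approx` would produce a nonzero integer of absolute value less
than `1`.
-/

/-! ### Galois-invariant sums of exponentials -/

theorem exists_int_polynomial_eval_zero_ne_zero_and_aeval_eq_zero {K : Type*} [Field K]
    [NumberField K] (S : Finset K) (hS : 0 ∉ S) :
    ∃ f : ℤ[X], f.eval 0 ≠ 0 ∧ ∀ x ∈ S, aeval x f = 0 := by
  have key : ∀ x : K, ∃ f : ℤ[X], x ≠ 0 → f.eval 0 ≠ 0 ∧ aeval x f = 0 := by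
    intro x
    by_cases hx : x = 0
    · exact ⟨0, fun h => (h hx).elim⟩
    · have hx' : IsAlgebraic ℤ x :=
        (IsFractionRing.isAlgebraic_iff ℤ ℚ K).mpr (Algebra.IsAlgebraic.isAlgebraic x)
      obtain ⟨f, hf, h⟩ := hx'.exists_nonzero_coeff_and_aeval_eq_zero
        (mem_nonZeroDivisors_of_ne_zero hx)
      exact ⟨f, fun _ => ⟨by rwa [← coeff_zero_eq_eval_zero], h⟩⟩
  choose f hf using key
  have hne : ∀ x ∈ S, x ≠ 0 := fun x hx h => hS (h ▸ hx)
  refine ⟨∏ x ∈ S, f x, ?_, fun x hx => ?_⟩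
  · rw [eval_prod]
    exact Finset.prod_ne_zero_iff.mpr fun x hx => (hf x (hne x hx)).1
  · rw [map_prod]
    exact Finset.prod_eq_zero hx (hf x (hne x hx)).2

/-- If `a` is a denominator for `x`, then `a ^ N` is one for the values at `x` of all integer
polynomials of degree at most `N`. -/
theorem isIntegral_pow_mul_aeval {K : Type*} [Field K] {a : ℤ} {x : K}
    (hx : IsIntegral ℤ ((a : K) * x)) (g : ℤ[X]) {N : ℕ} (hg : g.natDegree ≤ N) :
    IsIntegral ℤ ((a : K) ^ N * aeval x g) := by
  rw [aeval_eq_sum_range' (Nat.lt_succ_of_le hg), Finset.mul_sum]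
  refine IsIntegral.sum _ fun i hi => ?_
  have hi : i ≤ N := Nat.lt_succ_iff.mp (Finset.mem_range.mp hi)
  have : (a : K) ^ N * g.coeff i • x ^ i =
      (algebraMap ℤ K (a ^ (N - i) * g.coeff i)) * ((a : K) * x) ^ i := by
    rw [zsmul_eq_mul, mul_pow, ← Nat.sub_add_cancel hi, pow_add, Nat.sub_add_cancel hi]
    simp
    ring
  rw [this]
  exact isIntegral_algebraMap.mul (hx.pow i)

theorem exists_intCast_eq_of_forall_algEquiv_apply_eq {K : Type*} [Field K] [NumberField K]
    [IsGalois ℚ K] {t : K} (ht : IsIntegral ℤ t) (hfix : ∀ σ : Gal(K/ℚ), σ t = t) :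
    ∃ m : ℤ, (m : K) = t := by
  obtain ⟨q, rfl⟩ := (IsGalois.mem_range_algebraMap_iff_fixed t).mpr hfix
  have hq : IsIntegral ℤ q := (isIntegral_algebraMap_iff (algebraMap ℚ K).injective).mp ht
  obtain ⟨m, rfl⟩ := IsIntegrallyClosed.isIntegral_iff.mp hq
  exact ⟨m, by simp⟩

theorem exists_prime_gt_and_mul_pow_div_factorial_lt_one (B C : ℝ) (M : ℕ) :
    ∃ p : ℕ, M < p ∧ p.Prime ∧ B * (C ^ p / (p - 1).factorial) < 1 := by
  have h : Tendsto (fun n : ℕ => B * C * (C ^ n / n.factorial)) atTop (𝓝 0) := by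
    simpa using (FloorSemiring.tendsto_pow_div_factorial_atTop C).const_mul (B * C)
  obtain ⟨N, hN⟩ := eventually_atTop.mp (h.eventually_lt_const one_pos)
  obtain ⟨p, hp, hp'⟩ := Nat.exists_infinite_primes (M + N + 1)
  refine ⟨p, by omega, hp', ?_⟩
  calc B * (C ^ p / (p - 1).factorial) = B * C * (C ^ (p - 1) / (p - 1).factorial) := by
        rw [← mul_pow_sub_one hp'.ne_zero]
        ring
    _ < 1 := hN (p - 1) (by omega)

theorem map_aeval_int {R S F : Type*} [CommRing R] [CommRing S] [FunLike F R S] [RingHomClass F R S]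
    (φ : F) (x : R) (g : ℤ[X]) : φ (aeval x g) = aeval (φ x) g :=
  (aeval_algHom_apply (φ : R →+* S).toIntAlgHom x g).symm

/-- The arithmetic core of the Lindemann–Weierstrass theorem. Suppose the sum vanishes. Take an
integer polynomial `f` with nonzero constant term killing the nonzero exponents, and for a large
prime `p` the simultaneous approximations `p * g (φ x)` of `n * exp (φ x)` with `p ∤ n`. Replacing
the exponentials by their approximations and clearing denominators turns `0` into an integer `N`
(by Galois invariance) which is not divisible by `p` (because `H 0 ≠ 0`), yet has absolute value
less than `1`. -/
theorem sum_mul_cexp_ne_zero_of_forall_algEquiv {K : Type*} [Field K] [NumberField K]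
    [IsGalois ℚ K] (φ : K →+* ℂ) (H : K →₀ ℤ) (hH : ∀ (σ : Gal(K/ℚ)) x, H (σ x) = H x)
    (h0 : H 0 ≠ 0) : H.sum (fun x a => (a : ℂ) * Complex.exp (φ x)) ≠ 0 := by
  classical
  intro hsum
  set S := H.support.erase 0 with hS
  obtain ⟨f, hf0, hfS⟩ := exists_int_polynomial_eval_zero_ne_zero_and_aeval_eq_zero S
    (Finset.notMem_erase 0 _)
  have hfne : f ≠ 0 := by rintro rfl; simp at hf0
  obtain ⟨c, hc⟩ := LindemannWeierstrass.exp_polynomial_approx f hf0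
  set a := f.leadingCoeff with ha
  have ha0 : a ≠ 0 := leadingCoeff_ne_zero.mpr hfne
  set D := f.natDegree
  obtain ⟨p, hpM, hp, hlt⟩ := exists_prime_gt_and_mul_pow_div_factorial_lt_one
    (∑ x ∈ S, ‖(H x : ℂ)‖) (‖(a : ℂ)‖ ^ D * c) ((eval 0 f).natAbs + a.natAbs + (H 0).natAbs)
  obtain ⟨n, hpn, g, hg, happrox⟩ := hc p (by omega) hp
  have hroot : ∀ x ∈ S, φ x ∈ f.aroots ℂ := fun x hx => by
    rw [mem_aroots]
    refine ⟨hfne, ?_⟩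
    have := congrArg φ (hfS x hx)
    rwa [map_zero, map_aeval_int] at this
  -- `t` is a Galois-invariant algebraic integer, hence a rational integer `m`.
  set t : K := (a : K) ^ (p * D) * ∑ x ∈ S, (H x : K) * aeval x g with ht
  obtain ⟨m, hm⟩ : ∃ m : ℤ, (m : K) = t := by
    apply exists_intCast_eq_of_forall_algEquiv_apply_eq
    · rw [ht, Finset.mul_sum]
      refine IsIntegral.sum _ fun x hx => ?_
      rw [mul_left_comm]
      refine (isIntegral_algebraMap (R := ℤ) (x := H x)).mul
        (isIntegral_pow_mul_aeval ?_ g (hg.trans (Nat.sub_le _ _)))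
      simpa using isIntegral_leadingCoeff_smul f x (hfS x hx)
    · intro σ
      simp only [ht, map_mul, map_pow, map_intCast, map_sum]
      congr 1
      refine Finset.sum_equiv σ.toEquiv (fun x => ?_) fun x _ => ?_
      · simp [hS, hH]
      · have : σ (aeval x g) = aeval (σ x) g := by
          rw [map_aeval_int]
        simp [hH, this]
  have hmC : (m : ℂ) = (a : ℂ) ^ (p * D) * ∑ x ∈ S, (H x : ℂ) * aeval (φ x) g := by
    have := congrArg φ hm
    simp only [ht, map_mul, map_pow, map_intCast, map_sum] at this
    rw [this]
    congr 1
    refine Finset.sum_congr rfl fun x _ => ?_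
    rw [map_aeval_int]
  -- The vanishing sum, solved for the coefficient of `exp 0 = 1`.
  have hsum' : (H 0 : ℂ) = - ∑ x ∈ S, (H x : ℂ) * Complex.exp (φ x) := by
    rw [Finsupp.sum, ← Finset.add_sum_erase _ _ (Finsupp.mem_support_iff.mpr h0)] at hsum
    simpa using eq_neg_of_add_eq_zero_left hsum
  set N : ℤ := a ^ (p * D) * (n * H 0) + p * m with hN
  have hpI : Prime (p : ℤ) := Nat.prime_iff_prime_int.mp hp
  have hsmall : ∀ z : ℤ, z ≠ 0 → z.natAbs < p → ¬ (p : ℤ) ∣ z := fun z hz hlt h =>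
    hlt.not_ge (Nat.le_of_dvd (Int.natAbs_pos.mpr hz) (Int.natCast_dvd.mp h))
  have hN0 : N ≠ 0 := by
    intro h
    have : (p : ℤ) ∣ a ^ (p * D) * (n * H 0) := by
      rw [← dvd_add_left (dvd_mul_right (p : ℤ) m), ← hN, h]
      exact dvd_zero _
    rcases hpI.dvd_or_dvd this with h | h
    · exact hsmall a ha0 (by omega) (hpI.dvd_of_dvd_pow h)
    · rcases hpI.dvd_or_dvd h with h | h
      · exact hpn h
      · exact hsmall _ h0 (by omega) h
  have hNC : (N : ℂ) = -((a : ℂ) ^ (p * D) *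
      ∑ x ∈ S, (H x : ℂ) * (n • Complex.exp (φ x) - p • aeval (φ x) g)) := by
    rw [hN]
    push_cast
    rw [hmC, hsum']
    simp only [mul_sub, Finset.sum_sub_distrib, zsmul_eq_mul, nsmul_eq_mul,
      mul_left_comm _ (n : ℂ), mul_left_comm _ (p : ℂ), ← Finset.mul_sum]
    ring
  have hge : (1 : ℝ) ≤ ‖(N : ℂ)‖ := by
    rw [Complex.norm_intCast]
    exact_mod_cast Int.one_le_abs hN0
  refine hge.not_gt (lt_of_le_of_lt ?_ hlt)
  calc ‖(N : ℂ)‖ = ‖(a : ℂ)‖ ^ (p * D) *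
        ‖∑ x ∈ S, (H x : ℂ) * (n • Complex.exp (φ x) - p • aeval (φ x) g)‖ := by
        rw [hNC, norm_neg, norm_mul, norm_pow]
    _ ≤ ‖(a : ℂ)‖ ^ (p * D) * ∑ x ∈ S, ‖(H x : ℂ)‖ * (c ^ p / (p - 1).factorial) := by
        gcongr
        refine norm_sum_le_of_le _ fun x hx => ?_
        rw [norm_mul]
        gcongr
        exact happrox (hroot x hx)
    _ = _ := by
        rw [← Finset.sum_mul, mul_pow, ← pow_mul, mul_comm D p]
        ring

/-! ### The Hermite–Lindemann theorem -/

/-- The ring homomorphism from the group ring `ℤ[K]` of the additive group of `K` to `ℂ` that sends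
the basis element at `x` to `exp (φ x)`. -/
noncomputable def expLift {K : Type*} [Field K] (φ : K →+* ℂ) :
    AddMonoidAlgebra ℤ K →ₐ[ℤ] ℂ :=
  AddMonoidAlgebra.lift ℤ ℂ K
    (Complex.expMonoidHom.comp (AddMonoidHom.toMultiplicative (φ : K →+ ℂ)))

theorem expLift_apply {K : Type*} [Field K] (φ : K →+* ℂ)
    (F : AddMonoidAlgebra ℤ K) :
    expLift φ F = F.coeff.sum fun x a => (a : ℂ) * Complex.exp (φ x) := by
  simp [expLift, AddMonoidAlgebra.lift_apply, Complex.expMonoidHom_apply]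

theorem expLift_single {K : Type*} [Field K] (φ : K →+* ℂ) (x : K) (a : ℤ) :
    expLift φ (.single x a) = a * Complex.exp (φ x) := by
  simp [expLift, Complex.expMonoidHom_apply]

/-- The automorphism of the group ring `ℤ[K]` that a Galois automorphism `σ` of `K` induces on its
basis elements. -/
noncomputable def galAct {K : Type*} [Field K] [Algebra ℚ K] (σ : Gal(K/ℚ)) :
    AddMonoidAlgebra ℤ K ≃+* AddMonoidAlgebra ℤ K :=
  AddMonoidAlgebra.mapDomainRingEquiv ℤ (σ : K ≃+ K)

theorem galAct_single {K : Type*} [Field K] [Algebra ℚ K] (σ : Gal(K/ℚ)) (x : K) (a : ℤ) :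
    galAct σ (.single x a) = .single (σ x) a := by
  exact AddMonoidAlgebra.mapDomain_single

theorem coeff_galAct_apply {K : Type*} [Field K] [Algebra ℚ K] (σ : Gal(K/ℚ))
    (F : AddMonoidAlgebra ℤ K) (x : K) : (galAct σ F).coeff (σ x) = F.coeff x := by
  exact Finsupp.mapDomain_apply σ.injective F.coeff x

theorem galAct_mul {K : Type*} [Field K] [Algebra ℚ K] (σ τ : Gal(K/ℚ))
    (F : AddMonoidAlgebra ℤ K) : galAct (σ * τ) F = galAct σ (galAct τ F) := by
  ext x
  obtain ⟨y, rfl⟩ := (σ * τ).surjective x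
  rw [coeff_galAct_apply, AlgEquiv.mul_apply, coeff_galAct_apply, coeff_galAct_apply]

/-- The Lindemann–Weierstrass theorem over `ℤ`: exponentials of distinct elements of a Galois number
field embedded in `ℂ` are linearly independent over `ℤ`. -/
theorem expLift_injective {K : Type*} [Field K] [NumberField K] [IsGalois ℚ K]
    (φ : K →+* ℂ) : Function.Injective (expLift φ) := by
  refine (injective_iff_map_eq_zero _).mpr fun F hF => ?_
  by_contra hF0
  -- The norm of `F` is Galois-invariant, in the kernel, and nonzero as `ℤ[K]` is a domain.
  set P : AddMonoidAlgebra ℤ K := ∏ σ : Gal(K/ℚ), galAct σ F with hP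
  have hP0 : P ≠ 0 := Finset.prod_ne_zero_iff.mpr fun σ _ => by simpa using hF0
  have hPinv : ∀ τ : Gal(K/ℚ), galAct τ P = P := fun τ => by
    rw [hP, map_prod]
    exact Fintype.prod_equiv (Equiv.mulLeft τ) _ _ fun σ => (galAct_mul τ σ F).symm
  have hPφ : expLift φ P = 0 := by
    rw [hP, map_prod]
    refine Finset.prod_eq_zero (Finset.mem_univ 1) ?_
    rwa [show galAct (1 : Gal(K/ℚ)) F = F by ext x; exact coeff_galAct_apply 1 F x]
  have hPcoeff : ∀ (σ : Gal(K/ℚ)) x, P.coeff (σ x) = P.coeff x := fun σ x => by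
    conv_lhs => rw [← hPinv σ]
    exact coeff_galAct_apply σ P x
  obtain ⟨γ, hγ⟩ : ∃ γ, P.coeff γ ≠ 0 := by
    by_contra! h
    exact hP0 (by ext x; simpa using h x)
  -- Multiplying by the orbit sum of `-γ` moves the nonzero coefficient at `γ` to the exponent `0`.
  set Q : AddMonoidAlgebra ℤ K := ∑ σ : Gal(K/ℚ), .single (-σ γ) 1 with hQ
  have hQinv : ∀ τ : Gal(K/ℚ), galAct τ Q = Q := fun τ => by
    rw [hQ, map_sum]
    exact Fintype.sum_equiv (Equiv.mulLeft τ) _ _ fun σ => by simp [galAct_single]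
  refine sum_mul_cexp_ne_zero_of_forall_algEquiv φ (P * Q).coeff (fun σ x => ?_) ?_ ?_
  · conv_lhs => rw [← hPinv σ, ← hQinv σ, ← map_mul]
    exact coeff_galAct_apply σ (P * Q) x
  · have : (P * Q).coeff 0 = Fintype.card Gal(K/ℚ) * P.coeff γ := by
      simp [hQ, Finset.mul_sum, AddMonoidAlgebra.coeff_sum, hPcoeff]
    rw [this]
    exact mul_ne_zero (by exact_mod_cast Fintype.card_ne_zero) hγ
  · rw [← expLift_apply, map_mul, hPφ, zero_mul]

/-- The Hermite–Lindemann theorem. -/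
theorem transcendental_cexp_of_isAlgebraic {α : ℂ} (hα : IsAlgebraic ℚ α) (h0 : α ≠ 0) :
    Transcendental ℚ (Complex.exp α) := by
  intro hexp
  set K := IntermediateField.adjoin ℚ ((minpoly ℚ α).rootSet ℂ)
  have : IsSplittingField ℚ K (minpoly ℚ α) :=
    IntermediateField.adjoin_rootSet_isSplittingField (IsAlgClosed.splits _)
  have : FiniteDimensional ℚ K := IsSplittingField.finiteDimensional K (minpoly ℚ α)
  have : NumberField K := ⟨⟩
  have : Normal ℚ K := Normal.of_isSplittingField (minpoly ℚ α)
  have : IsGalois ℚ K := ⟨⟩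
  have hαK : α ∈ K := IntermediateField.subset_adjoin _ _ <|
    (mem_rootSet_of_ne (minpoly.ne_zero hα.isIntegral)).mpr (minpoly.aeval ℚ α)
  set x : K := ⟨α, hαK⟩
  have hx0 : x ≠ 0 := fun h => h0 (congrArg Subtype.val h)
  obtain ⟨r, hr0, hr⟩ := (IsFractionRing.isAlgebraic_iff ℤ ℚ ℂ).mpr hexp
  -- Evaluated at the basis element at `x` of `ℤ[K]`, the polynomial `r` has coefficient `r.coeff i`
  -- at the exponent `i • x`; these exponents are distinct as `x ≠ 0`.
  have hF : aeval (AddMonoidAlgebra.single x (1 : ℤ)) r = 0 := by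
    refine expLift_injective (algebraMap K ℂ) ?_
    rw [map_zero, ← aeval_algHom_apply, expLift_single, Int.cast_one, one_mul]
    exact hr
  refine hr0 (Polynomial.ext fun i => ?_)
  rcases lt_or_ge r.natDegree i with hi | hi
  · exact coeff_eq_zero_of_natDegree_lt hi
  have := congrArg (fun F => F.coeff (i • x)) hF
  simpa [aeval_eq_sum_range, AddMonoidAlgebra.coeff_sum, AddMonoidAlgebra.single_pow,
    Finsupp.single_apply, hx0, Nat.lt_succ_iff, hi] using this

theorem transcendental_log_two : Transcendental ℚ ((Real.log 2 : ℝ) : ℂ) := fun h => by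
  refine transcendental_cexp_of_isAlgebraic h ?_ ?_
  · exact_mod_cast (Real.log_pos one_lt_two).ne'
  · rw [← Complex.ofReal_exp, Real.exp_log two_pos]
    simpa using isAlgebraic_natCast (R := ℚ) (A := ℂ) 2

theorem transcendental_pi_div_four : Transcendental ℚ ((Real.pi / 4 : ℝ) : ℂ) := fun h => by
  have hI : IsAlgebraic ℚ Complex.I :=
    (IsIntegral.of_pow (n := 2) (R := ℚ) two_pos (by simpa using isIntegral_one.neg)).isAlgebraic
  refine transcendental_cexp_of_isAlgebraic ((h.mul hI).mul (isAlgebraic_natCast 4)) ?_ ?_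
  · simp [Real.pi_ne_zero]
  · have : ((Real.pi / 4 : ℝ) : ℂ) * Complex.I * (4 : ℕ) = Real.pi * Complex.I := by
      push_cast; ring
    rw [this, Complex.exp_pi_mul_I]
    exact isAlgebraic_one.neg

theorem transcendental_exp_one_sub_one : Transcendental ℚ ((Real.exp 1 - 1 : ℝ) : ℂ) := fun h => by
  refine transcendental_cexp_of_isAlgebraic isAlgebraic_one one_ne_zero ?_
  simpa using h.add isAlgebraic_one

/-! ### Limits of algebraic functions -/

/-- A limit of an algebraic function over `K` is algebraic over `K`: divide the equation by the
highest power `n ^ d` of `n` occurring in it and let `n` tend to infinity. The coefficients of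
`n ^ d` give a nonzero polynomial that vanishes at the limit. -/
theorem IsAlgebraicFunction.isAlgebraic_of_tendsto {K : Subfield ℂ} {f : ℕ+ → ℂ} {l : ℂ}
    (hf : IsAlgebraicFunction K f) (hl : Tendsto f atTop (𝓝 l)) : IsAlgebraic K l := by
  obtain ⟨k, q, hq, h⟩ := hf
  obtain ⟨i₀, -, hi₀⟩ := Finset.exists_max_image Finset.univ (fun i => (q i).degree)
    Finset.univ_nonempty
  have hqi₀ : q i₀ ≠ 0 := fun h0 => hq <| degree_eq_bot.mp <| le_bot_iff.mp <| by
    simpa [h0] using hi₀ (Fin.last k) (Finset.mem_univ _)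
  set d := (q i₀).natDegree with hd
  have hdeg : ∀ i, (q i).natDegree ≤ d := fun i =>
    natDegree_le_natDegree (hi₀ i (Finset.mem_univ _))
  have hinv : Tendsto (fun n : ℕ+ => ((n : ℕ) : ℂ)⁻¹) atTop (𝓝 0) :=
    tendsto_inv_atTop_nhds_zero_nat.comp tendsto_PNat_val_atTop_atTop
  -- `aeval n q / n ^ d` is the value at `n⁻¹` of the reflected polynomial, whose constant term is
  -- the coefficient of `q` at `d`.
  have hlim : Tendsto (fun n : ℕ+ => ∑ i : Fin (k + 1),
      aeval ((n : ℕ) : ℂ)⁻¹ (reflect d (q i)) * f n ^ (i : ℕ)) atTop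
      (𝓝 (∑ i : Fin (k + 1), aeval (0 : ℂ) (reflect d (q i)) * l ^ (i : ℕ))) :=
    tendsto_finsetSum _ fun i _ =>
      (((reflect d (q i)).continuous_aeval.tendsto 0).comp hinv).mul (hl.pow _)
  have hzero : ∀ n : ℕ+, ∑ i : Fin (k + 1),
      aeval ((n : ℕ) : ℂ)⁻¹ (reflect d (q i)) * f n ^ (i : ℕ) = 0 := fun n => by
    have hn : ((n : ℕ) : ℂ) ≠ 0 := Nat.cast_ne_zero.mpr n.ne_zero
    refine (mul_eq_zero.mp ?_).resolve_right (pow_ne_zero d hn)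
    rw [← h n, Finset.sum_mul]
    refine Finset.sum_congr rfl fun i _ => ?_
    let _ := invertibleOfNonzero hn
    rw [mul_right_comm, ← invOf_eq_inv, aeval_def, aeval_def,
      eval₂_reflect_mul_pow _ _ d _ (hdeg i)]
  simp only [hzero] at hlim
  refine ⟨∑ i : Fin (k + 1), C ((q i).coeff d) * X ^ (i : ℕ), fun h0 => ?_, ?_⟩
  · have := congrArg (fun r => coeff r (i₀ : ℕ)) h0
    simp [finsetSum_coeff, coeff_C_mul, coeff_X_pow, Fin.val_inj] at this
    exact hqi₀ (leadingCoeff_eq_zero.mp this)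
  · rw [map_sum]
    refine Eq.trans (Finset.sum_congr rfl fun i _ => ?_) (tendsto_nhds_unique hlim tendsto_const_nhds)
    rw [map_mul, aeval_C, map_pow, aeval_X, ← coeff_zero_eq_aeval_zero', coeff_reflect,
      revAt_zero]

theorem isTranscendentalFunction_of_tendsto {f : ℕ+ → ℂ} {l : ℂ} (hl : Tendsto f atTop (𝓝 l))
    (h : Transcendental ℚ l) : IsTranscendentalFunction algebraicNumbers f := fun hf => by
  exact h.algebraicClosure (hf.isAlgebraic_of_tendsto hl)

/-! ### Limits of the three sums -/

theorem tendsto_sum_Icc_ofReal {u : ℕ → ℝ} {l : ℝ}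
    (h : Tendsto (fun n => ∑ i ∈ Finset.range n, u (i + 1)) atTop (𝓝 l)) :
    Tendsto (fun n : ℕ+ => ∑ j ∈ Finset.Icc 1 (n : ℕ), (u j : ℂ)) atTop (𝓝 (l : ℂ)) := by
  refine (((Complex.continuous_ofReal.tendsto l).comp h).comp
    tendsto_PNat_val_atTop_atTop).congr fun n => ?_
  simp only [Function.comp_apply, Complex.ofReal_sum]
  rw [Finset.range_eq_Ico, Finset.sum_Ico_add' (fun j => (u j : ℂ)) 0 n 1]
  rfl

/-- The alternating harmonic series converges, so by Abel's limit theorem its sum is the limit of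
`log (1 + x)` as `x` tends to `1` from below. -/
theorem tendsto_sum_alternating_inv_log_two :
    Tendsto (fun n => ∑ i ∈ Finset.range n, (-1 : ℝ) ^ i / (i + 1)) atTop (𝓝 (Real.log 2)) := by
  obtain ⟨l, h⟩ :
      ∃ l, Tendsto (fun n ↦ ∑ i ∈ Finset.range n, (-1 : ℝ) ^ i / (i + 1)) atTop (𝓝 l) := by
    simp_rw [div_eq_mul_inv]
    apply Antitone.tendsto_alternating_series_of_tendsto_zero
    · exact fun _ _ _ ↦ by gcongr
    · simpa using tendsto_one_div_add_atTop_nhds_zero_nat (𝕜 := ℝ)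
  have hid : Tendsto (fun x : ℝ => x) (𝓝[<] 1) (𝓝 1) := nhdsWithin_le_nhds
  have abel := (Real.tendsto_tsum_powerSeries_nhdsWithin_lt h).mul hid
  rw [mul_one] at abel
  have hlog : Tendsto (fun x : ℝ => Real.log (1 + x)) (𝓝[<] 1) (𝓝 (Real.log 2)) := by
    have := (hid.const_add 1).log (by norm_num)
    rwa [one_add_one_eq_two] at this
  suffices l = Real.log 2 from this ▸ h
  refine tendsto_nhds_unique_of_eventuallyEq abel hlog ?_
  filter_upwards [Ioo_mem_nhdsLT (show (0 : ℝ) < 1 by norm_num)] with x hx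
  have hs := (Real.hasSum_pow_div_log_of_abs_lt_one (x := -x)
    (by rw [abs_neg, abs_of_pos hx.1]; exact hx.2)).neg
  rw [sub_neg_eq_add, neg_neg] at hs
  rw [← hs.tsum_eq, ← tsum_mul_right]
  refine tsum_congr fun n => ?_
  rw [neg_pow x]
  ring

theorem tendsto_altHarmonicSum :
    Tendsto altHarmonicSum atTop (𝓝 ((Real.log 2 : ℝ) : ℂ)) := by
  refine (tendsto_sum_Icc_ofReal (u := fun j => (-1) ^ (j - 1) / j) ?_).congr fun n => ?_
  · simpa using tendsto_sum_alternating_inv_log_two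
  · simp [altHarmonicSum]

theorem tendsto_leibnizSum : Tendsto leibnizSum atTop (𝓝 ((Real.pi / 4 : ℝ) : ℂ)) := by
  refine (tendsto_sum_Icc_ofReal (u := fun j => (-1) ^ (j - 1) / (2 * j - 1)) ?_).congr
    fun n => ?_
  · refine Real.tendsto_sum_pi_div_four.congr fun n => Finset.sum_congr rfl fun i _ => ?_
    push_cast
    rw [show (2 * ((i : ℝ) + 1) - 1) = 2 * i + 1 by ring]
  · simp [leibnizSum]

theorem tendsto_invFactorialSum :
    Tendsto invFactorialSum atTop (𝓝 ((Real.exp 1 - 1 : ℝ) : ℂ)) := by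
  refine (tendsto_sum_Icc_ofReal (u := fun j => 1 / j.factorial) ?_).congr fun n => ?_
  · have h := NormedSpace.expSeries_div_hasSum_exp (1 : ℝ)
    rw [← Real.exp_eq_exp_ℝ, ← hasSum_nat_add_iff' 1] at h
    simpa using h.tendsto_sum_nat
  · simp [invFactorialSum]

theorem mainTheorem8 :
    (IsTranscendentalFunction algebraicNumbers altHarmonicSum ∧
      IsTranscendentalFunction algebraicNumbers leibnizSum ∧
      IsTranscendentalFunction algebraicNumbers invFactorialSum) ∧
    (Tendsto altHarmonicSum atTop (𝓝 ((Real.log 2 : ℝ) : ℂ)) ∧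
      Tendsto leibnizSum atTop (𝓝 ((Real.pi / 4 : ℝ) : ℂ)) ∧
      Tendsto invFactorialSum atTop (𝓝 ((Real.exp 1 - 1 : ℝ) : ℂ))) ∧
    (Transcendental ℚ ((Real.log 2 : ℝ) : ℂ) ∧
      Transcendental ℚ ((Real.pi / 4 : ℝ) : ℂ) ∧
      Transcendental ℚ ((Real.exp 1 - 1 : ℝ) : ℂ)) := by
  exact ⟨⟨isTranscendentalFunction_of_tendsto tendsto_altHarmonicSum transcendental_log_two,
      isTranscendentalFunction_of_tendsto tendsto_leibnizSum transcendental_pi_div_four,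
      isTranscendentalFunction_of_tendsto tendsto_invFactorialSum transcendental_exp_one_sub_one⟩,
    ⟨tendsto_altHarmonicSum, tendsto_leibnizSum, tendsto_invFactorialSum⟩,
    ⟨transcendental_log_two, transcendental_pi_div_four, transcendental_exp_one_sub_one⟩⟩
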